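/- \textbf{Setting.} Let $m_0,m_1,m_2,\mu>0$, $\mathrm m_i=\frac{m_0m_i}{m_0+\mu m_i}$, $\mathrm M_i=m_0+\mu m_i$, $\mathbb T=\mathbb R/2\pi\mathbb Z$, and let $(k^{(1)},k^{(2)},k^{(3)})$ be an orthonormal frame of $\mathbb R^3$. Consider states $(y^{(1)},y^{(2)},x^{(1)},x^{(2)})\in(\mathbb R^3)^4$ for which each Kepler Hamiltonian $\frac{|y^{(i)}|^2}{2\mathrm m_i}-\frac{\mathrm m_i\mathrm M_i}{|x^{(i)}|}$ generates a nondegenerate ellipse of nonvanishing eccentricity, with semi-major axis $a_i$, unit perihelion direction $P^{(i)}$ and mean anomaly $\ell_i$. Put $\Lambda_i=\mathrm m_i\sqrt{\mathrm M_ia_i}$, $C^{(i)}=x^{(i)}\times y^{(i)}$, $C=C^{(1)}+C^{(2)}$, $G_i=|C^{(i)}|$, $G=|C|$, $Z=C\cdot k^{(3)}$, $\nu_1=k^{(3)}\times C$ and $\nu=C\times C^{(1)}$. For $u,v\perp w$ let $\alpha_w(u,v)$ be the angle from $u$ to $v$, counterclockwise with respect to $w$, and let $\zeta=\alpha_{k^{(3)}}(k^{(1)},\nu_1)$.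 \emph{$\mathrm{RPS}_\pi$ coordinates.} With $\gamma_0=\alpha_C(\nu_1,\nu)$ and $\gamma_i=\alpha_{C^{(i)}}(\nu,P^{(i)})$, these are $(\Lambda_1,\Lambda_2,\lambda_1,\lambda_2,\eta_1,\eta_2,\xi_1,\xi_2,p,q)$ together with $(Z,\zeta)$, where $$\lambda_1=\ell_1+\gamma_1+\gamma_0,\quad \lambda_2=\ell_2+\gamma_2-\gamma_0,\quad \eta_1+i\xi_1=\sqrt{2(\Lambda_1-G_1)}\,e^{-i(\gamma_1+\gamma_0)},$$ $$\eta_2+i\xi_2=-\sqrt{2(\Lambda_2-G_2)}\,e^{i(-\gamma_2+\gamma_0)},\quad p+iq=-\sqrt{2(G+G_2-G_1)}\,e^{i\gamma_0},$$ extended by continuity to the co-planar states with $C^{(1)}\parallel -C^{(2)}\parallel C$ (where $p=q=0$). \emph{Perihelia coordinates.} With $\mathrm n_1=C\times P^{(1)}$, $\nu_2=P^{(1)}\times C^{(2)}$, $\mathrm n_2=C^{(2)}\times P^{(2)}$ and $\nu_1$ all nonzero, these are $\hat{\mathrm p}=(\Lambda_1,\Lambda_2,G_2,\Theta,\ell_1,\ell_2,\mathrm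 g_2,\vartheta)$ together with $(Z,G,\zeta,\mathrm g)$, where $$\Theta=C\cdot P^{(1)},\quad \vartheta=\alpha_{P^{(1)}}(\mathrm n_1,\nu_2),\quad \mathrm g=\alpha_C(\nu_1,\mathrm n_1),\quad \mathrm g_2=\alpha_{C^{(2)}}(\nu_2,\mathrm n_2).$$ \emph{Domains.} Let $0<\alpha_-<\alpha_+<1$, $k_\pm=\frac{m_1}{m_2}\sqrt{\frac{m_0+\mu m_2}{m_0+\mu m_1}\alpha_\pm}$, $0<\Lambda_-<\Lambda_+$, and $$\mathcal L=\{(\Lambda_1,\Lambda_2):\ \Lambda_-<\Lambda_2<\Lambda_+,\ k_-\Lambda_2<\Lambda_1<k_+\Lambda_2\},\qquad \mathcal M_\varepsilon=\mathcal L\times\mathbb T^2\times B^6_\varepsilon(0),$$ with $B^6_\varepsilon(0)$ the open Euclidean ball in the variables $(\eta,\xi,p,q)$. For $G>0$ let $\mathcal M_\varepsilon(G)$ be the part of $\mathcal M_\varepsilon$ on which $\Lambda_1-\Lambda_2-\frac{\eta_1^2+\xi_1^2}{2}+\frac{\eta_2^2+\xi_2^2}{2}+\frac{p^2+q^2}{2}=G$,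 and let $\widehat{\mathcal M}'_\varepsilon(G)$ be the set of $\hat{\mathrm p}$ such that for all $\mathrm g,\zeta\in\mathbb T$ and $|Z|<G$ the point with perihelia coordinates $(\hat{\mathrm p},Z,G,\zeta,\mathrm g)$ is the image, under the change from $\mathrm{RPS}_\pi$ to perihelia coordinates, of a point of $\mathcal M_\varepsilon(G)$ (with the same $(Z,\zeta)$). Let $\mathcal D(G)$ be the set of $\hat{\mathrm p}$ with $$0<G_2<\Lambda_2,\quad |\Theta|<\min\{G,G_2\},\quad \vartheta\in(-\pi,\pi),$$ $$\sqrt{G^2+G_2^2-2\Theta^2+2\sqrt{G^2-\Theta^2}\sqrt{G_2^2-\Theta^2}\cos\vartheta}<\Lambda_1,$$ the last left hand side being the value of $G_1$; these conditions express that the perihelia coordinates are those of two ellipses of nonvanishing eccentricity with nonvanishing nodes and $\vartheta\neq\pi$. \textbf{Proposition.} There exists $c_1\in(0,1)$, depending only on $\Lambda_+/G$ and $\Lambda_- /G$, such that for all masses, $\alpha_\pm$, $\varepsilon>0$ and $\gamma<c_1^2\varepsilon^2$ as above the following holds. Let $\mathcal N_1(G,\varepsilon)$ be the set of all $\hat{\mathrm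 p}$, with arbitrary $(\ell_1,\ell_2,\mathrm g_2)\in\mathbb T^3$, such that $$(\Lambda_1,\Lambda_2)\in\mathcal L,\quad |\Lambda_1-\Lambda_2-G|<c_1^2\varepsilon^2,\quad \Lambda_2-c_1^2\varepsilon^2<G_2<\Lambda_2-\gamma,$$ $$\Theta^2<c_1^2G\varepsilon^2,\quad \vartheta^2<c_1^2\frac{\varepsilon^2}{G}\qquad(\vartheta\in(-\pi,\pi]).$$ Then $\mathcal N_1(G,\varepsilon)\cap\mathcal D(G)\subset\widehat{\mathcal M}'_\varepsilon(G)$. -/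

import Mathlib

open scoped Matrix

noncomputable section

namespace ThreeBody

/-! ### Vectors in three-dimensional Euclidean space -/

/-- Vectors of `ℝ³`, in coordinates relative to the fixed orthonormal frame `(k₁, k₂, k₃)`. -/
abbrev V3 : Type := Fin 3 → ℝ

/-- The Euclidean length of a vector. -/
def len (v : V3) : ℝ := Real.sqrt (v ⬝ᵥ v)

/-- The vector `k₁` of the fixed frame. -/
def k1 : V3 := ![1, 0, 0]

/-- The vector `k₃` of the fixed frame. -/
def k3 : V3 := ![0, 0, 1]

/-- For nonzero `u, v ⟂ w` with `w ≠ 0`: the angle from `u` to `v`, counted counterclockwise with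
respect to the orientation established by `w`. One has `u ⬝ v = |u||v| cos` and
`u × v = |u||v| sin • w/|w|`. -/
def ang (w u v : V3) : Real.Angle :=
  ((Complex.arg ⟨u ⬝ᵥ v, (w ⬝ᵥ (u ⨯₃ v)) / len w⟩ : ℝ) : Real.Angle)

/-! ### One Kepler problem, with Hamiltonian `|y|²/(2m) - mM/|x|` -/

/-- The Kepler Hamiltonian. -/
def keplerEnergy (m M : ℝ) (y x : V3) : ℝ := (y ⬝ᵥ y) / (2 * m) - m * M / len x

/-- The angular momentum `x × y`. -/
def angMom (y x : V3) : V3 := x ⨯₃ y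

/-- The semi-major axis of the instantaneous ellipse. -/
def semiMajor (m M : ℝ) (y x : V3) : ℝ := -(m * M) / (2 * keplerEnergy m M y x)

/-- The eccentricity (Laplace-Runge-Lenz) vector `y × (x × y) / (m² M) - x / |x|`: it points to the
perihelion of the instantaneous ellipse and its length is the eccentricity. -/
def eccVector (m M : ℝ) (y x : V3) : V3 :=
  (m ^ 2 * M)⁻¹ • (y ⨯₃ angMom y x) - (len x)⁻¹ • x

/-- The eccentricity of the instantaneous ellipse. -/
def ecc (m M : ℝ) (y x : V3) : ℝ := len (eccVector m M y x)

/-- The unit vector in the direction of the perihelion. -/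
def periDir (m M : ℝ) (y x : V3) : V3 := (ecc m M y x)⁻¹ • eccVector m M y x

/-- The action `Λ = m √(M a)`. -/
def Lam (m M : ℝ) (y x : V3) : ℝ := m * Real.sqrt (M * semiMajor m M y x)

/-- The unit vector `C/|C| × P` of the orbital plane, orthogonal to the perihelion direction `P`. -/
def periNormal (m M : ℝ) (y x : V3) : V3 :=
  ((len (angMom y x))⁻¹ • angMom y x) ⨯₃ periDir m M y x

/-- The eccentric anomaly `u`, a representative in `(-π, π]`: it is determined by
`x = a (cos u - e) P + a √(1 - e²) sin u (C/|C| × P)`. -/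
def eccAnomaly (m M : ℝ) (y x : V3) : ℝ :=
  Complex.arg ⟨(x ⬝ᵥ periDir m M y x) / semiMajor m M y x + ecc m M y x,
    (x ⬝ᵥ periNormal m M y x) /
      (semiMajor m M y x * Real.sqrt (1 - ecc m M y x ^ 2))⟩

/-- The mean anomaly, given by Kepler's equation `ℓ = u - e sin u`. This is the area of the elliptic
sector from the perihelion to `x`, normalized so that the whole ellipse has area `2π`. -/
def meanAnomaly (m M : ℝ) (y x : V3) : Real.Angle :=
  ((eccAnomaly m M y x - ecc m M y x * Real.sin (eccAnomaly m M y x) : ℝ) : Real.Angle)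

/-- The Kepler orbit through `(y, x)` is a nondegenerate ellipse of nonvanishing eccentricity. -/
def IsNoncircularEllipse (m M : ℝ) (y x : V3) : Prop :=
  x ≠ 0 ∧ keplerEnergy m M y x < 0 ∧ angMom y x ≠ 0 ∧ eccVector m M y x ≠ 0

/-! ### The two-planet phase space -/

/-- Cartesian impulse-position coordinates of the two planets. -/
@[ext]
structure State where
  y₁ : V3
  y₂ : V3
  x₁ : V3
  x₂ : V3

/-- The masses `m₀, μ m₁, μ m₂` of the star and of the planets. -/
@[ext]
structure Masses where
  m₀ : ℝ
  m₁ : ℝ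
  m₂ : ℝ
  μ : ℝ

/-- All the mass parameters are positive. -/
def Masses.Pos (S : Masses) : Prop := 0 < S.m₀ ∧ 0 < S.m₁ ∧ 0 < S.m₂ ∧ 0 < S.μ

/-- Reduced mass of the first planet in the heliocentric reduction. -/
def Masses.rm₁ (S : Masses) : ℝ := S.m₀ * S.m₁ / (S.m₀ + S.μ * S.m₁)

/-- Reduced mass of the second planet in the heliocentric reduction. -/
def Masses.rm₂ (S : Masses) : ℝ := S.m₀ * S.m₂ / (S.m₀ + S.μ * S.m₂)

/-- Central mass of the first Kepler problem in the heliocentric reduction. -/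
def Masses.cm₁ (S : Masses) : ℝ := S.m₀ + S.μ * S.m₁

/-- Central mass of the second Kepler problem in the heliocentric reduction. -/
def Masses.cm₂ (S : Masses) : ℝ := S.m₀ + S.μ * S.m₂

namespace State

/-- Angular momentum of the first planet. -/
def C₁ (s : State) : V3 := angMom s.y₁ s.x₁

/-- Angular momentum of the second planet. -/
def C₂ (s : State) : V3 := angMom s.y₂ s.x₂

/-- Total angular momentum. -/
def C (s : State) : V3 := s.C₁ + s.C₂

/-- `G₁ = |C₁|`. -/
def G₁ (s : State) : ℝ := len s.C₁

/-- `G₂ = |C₂|`. -/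
def G₂ (s : State) : ℝ := len s.C₂

/-- `G = |C|`. -/
def G (s : State) : ℝ := len s.C

/-- `Z = C · k₃`. -/
def Z (s : State) : ℝ := s.C ⬝ᵥ k3

/-- The node `ν₁ = k₃ × C`. -/
def ν₁ (s : State) : V3 := k3 ⨯₃ s.C

/-- `ζ`, the angle from `k₁` to `ν₁` around `k₃`. -/
def ζ (s : State) : Real.Angle := ang k3 k1 s.ν₁

/-- The action `Λ₁`. -/
def Λ₁ (S : Masses) (s : State) : ℝ := Lam S.rm₁ S.cm₁ s.y₁ s.x₁

/-- The action `Λ₂`. -/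
def Λ₂ (S : Masses) (s : State) : ℝ := Lam S.rm₂ S.cm₂ s.y₂ s.x₂

/-- The mean anomaly `ℓ₁`. -/
def ℓ₁ (S : Masses) (s : State) : Real.Angle := meanAnomaly S.rm₁ S.cm₁ s.y₁ s.x₁

/-- The mean anomaly `ℓ₂`. -/
def ℓ₂ (S : Masses) (s : State) : Real.Angle := meanAnomaly S.rm₂ S.cm₂ s.y₂ s.x₂

/-- The perihelion direction of the first planet. -/
def P₁ (S : Masses) (s : State) : V3 := periDir S.rm₁ S.cm₁ s.y₁ s.x₁

/-- The perihelion direction of the second planet. -/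
def P₂ (S : Masses) (s : State) : V3 := periDir S.rm₂ S.cm₂ s.y₂ s.x₂

/-- Both planets move on nondegenerate noncircular ellipses. -/
def Elliptic (S : Masses) (s : State) : Prop :=
  IsNoncircularEllipse S.rm₁ S.cm₁ s.y₁ s.x₁ ∧ IsNoncircularEllipse S.rm₂ S.cm₂ s.y₂ s.x₂

end State

/-! ### The coordinates `RPS_π` -/

/-- The coordinates `RPS_π` without the cyclic pair `(Z, ζ)`. -/
@[ext]
structure RPSHat where
  Λ₁ : ℝ
  Λ₂ : ℝ
  lam₁ : Real.Angle
  lam₂ : Real.Angle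
  η₁ : ℝ
  η₂ : ℝ
  ξ₁ : ℝ
  ξ₂ : ℝ
  p : ℝ
  q : ℝ

namespace State

open scoped Classical in
/-- The mutual node `ν = C × C₁ = C₂ × C₁`. Where this vanishes (co-planar motions) it is replaced
by `ν₁`. In the retrograde co-planar case `C₁ ∥ -C₂ ∥ C` the angles `γ₁ + γ` and `γ₂ - γ` below do
not depend on the direction that is used in place of `ν` in the plane orthogonal to `C`, while
`p = q = 0`; so this is the regular extension of `RPS_π` to that case. -/
def ν (s : State) : V3 := if s.C ⨯₃ s.C₁ ≠ 0 then s.C ⨯₃ s.C₁ else s.ν₁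

/-- `γ`, the angle from `ν₁` to `ν` around `C`. -/
def γ (s : State) : Real.Angle := ang s.C s.ν₁ s.ν

/-- `γ₁`, the angle from `ν` to the perihelion `P₁` around `C₁`. -/
def γ₁ (S : Masses) (s : State) : Real.Angle := ang s.C₁ s.ν (s.P₁ S)

/-- `γ₂`, the angle from `ν` to the perihelion `P₂` around `C₂`. -/
def γ₂ (S : Masses) (s : State) : Real.Angle := ang s.C₂ s.ν (s.P₂ S)

/-- Where `RPS_π` is defined (noncircular motions): the node `ν₁` does not vanish, and the motion is
either not co-planar or co-planar with the second planet retrograde (`G = G₁ - G₂`). -/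
def RPSDomain (S : Masses) (s : State) : Prop :=
  s.Elliptic S ∧ s.ν₁ ≠ 0 ∧ (s.C ⨯₃ s.C₁ ≠ 0 ∨ s.G = s.G₁ - s.G₂)

/-- The `RPS_π` coordinates of a state, without `(Z, ζ)`:
`λ₁ = ℓ₁ + γ₁ + γ`, `λ₂ = ℓ₂ + γ₂ - γ`,
`η₁ + i ξ₁ = √(2(Λ₁ - G₁)) exp(-i(γ₁ + γ))`,
`η₂ + i ξ₂ = -√(2(Λ₂ - G₂)) exp(i(-γ₂ + γ))`,
`p + i q = -√(2(G + G₂ - G₁)) exp(i γ)`. -/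
def rpsHat (S : Masses) (s : State) : RPSHat where
  Λ₁ := s.Λ₁ S
  Λ₂ := s.Λ₂ S
  lam₁ := s.ℓ₁ S + s.γ₁ S + s.γ
  lam₂ := s.ℓ₂ S + s.γ₂ S - s.γ
  η₁ := Real.sqrt (2 * (s.Λ₁ S - s.G₁)) * (-(s.γ₁ S + s.γ)).cos
  ξ₁ := Real.sqrt (2 * (s.Λ₁ S - s.G₁)) * (-(s.γ₁ S + s.γ)).sin
  η₂ := -Real.sqrt (2 * (s.Λ₂ S - s.G₂)) * (-s.γ₂ S + s.γ).cos
  ξ₂ := -Real.sqrt (2 * (s.Λ₂ S - s.G₂)) * (-s.γ₂ S + s.γ).sin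
  p := -Real.sqrt (2 * (s.G + s.G₂ - s.G₁)) * s.γ.cos
  q := -Real.sqrt (2 * (s.G + s.G₂ - s.G₁)) * s.γ.sin

end State

/-- The square of the Euclidean norm of `z = (η, ξ, p, q) ∈ ℝ⁶`. -/
def RPSHat.zSq (w : RPSHat) : ℝ :=
  w.η₁ ^ 2 + w.η₂ ^ 2 + w.ξ₁ ^ 2 + w.ξ₂ ^ 2 + w.p ^ 2 + w.q ^ 2

/-- The total angular momentum as a function of the `RPS_π` coordinates. -/
def RPSHat.G (w : RPSHat) : ℝ :=
  w.Λ₁ - w.Λ₂ - (w.η₁ ^ 2 + w.ξ₁ ^ 2) / 2 + (w.η₂ ^ 2 + w.ξ₂ ^ 2) / 2 + (w.p ^ 2 + w.q ^ 2) / 2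

/-! ### The perihelia coordinates -/

/-- The perihelia coordinates without `(Z, G, ζ, g)`. -/
@[ext]
structure PHat where
  Λ₁ : ℝ
  Λ₂ : ℝ
  G₂ : ℝ
  Θ : ℝ
  ℓ₁ : Real.Angle
  ℓ₂ : Real.Angle
  g₂ : Real.Angle
  ϑ : Real.Angle

namespace State

/-- The node `n₁ = C × P₁`. -/
def n₁ (S : Masses) (s : State) : V3 := s.C ⨯₃ s.P₁ S

/-- The node `ν₂ = P₁ × C₂`. -/
def ν₂ (S : Masses) (s : State) : V3 := s.P₁ S ⨯₃ s.C₂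

/-- The node `n₂ = C₂ × P₂`. -/
def n₂ (S : Masses) (s : State) : V3 := s.C₂ ⨯₃ s.P₂ S

/-- Where the perihelia coordinates are defined. -/
def PDomain (S : Masses) (s : State) : Prop :=
  s.Elliptic S ∧ s.ν₁ ≠ 0 ∧ s.n₁ S ≠ 0 ∧ s.ν₂ S ≠ 0 ∧ s.n₂ S ≠ 0

/-- The perihelia coordinates of a state, without `(Z, G, ζ, g)`. -/
def pHat (S : Masses) (s : State) : PHat where
  Λ₁ := s.Λ₁ S
  Λ₂ := s.Λ₂ S
  G₂ := s.G₂
  Θ := s.C ⬝ᵥ s.P₁ S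
  ℓ₁ := s.ℓ₁ S
  ℓ₂ := s.ℓ₂ S
  g₂ := ang s.C₂ (s.ν₂ S) (s.n₂ S)
  ϑ := ang (s.P₁ S) (s.n₁ S) (s.ν₂ S)

/-- The angle `g` conjugated to `G` in the perihelia coordinates. -/
def g (S : Masses) (s : State) : Real.Angle := ang s.C s.ν₁ (s.n₁ S)

end State

/-- The value of `G₁ = |C - C₂|` in terms of the perihelia coordinates. -/
def PHat.G₁ (G : ℝ) (a : PHat) : ℝ :=
  Real.sqrt (G ^ 2 + a.G₂ ^ 2 - 2 * a.Θ ^ 2 +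
    2 * Real.sqrt (G ^ 2 - a.Θ ^ 2) * Real.sqrt (a.G₂ ^ 2 - a.Θ ^ 2) * a.ϑ.cos)

/-- The domain of the perihelia coordinates at total angular momentum `G`: the two instantaneous
orbits are ellipses of nonvanishing eccentricity (`0 < G₂ < Λ₂` and `G₁ < Λ₁`), the nodes `n₁`, `ν₂`
do not vanish (`|Θ| < G` and `|Θ| < G₂`), and the angle `ϑ` varies in `(-π, π)`. -/
def perihelionDomain (G : ℝ) : Set PHat :=
  {a | 0 < a.G₂ ∧ a.G₂ < a.Λ₂ ∧ |a.Θ| < G ∧ |a.Θ| < a.G₂ ∧ a.ϑ ≠ (Real.pi : Real.Angle) ∧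
    a.G₁ G < a.Λ₁}

/-! ### The domains -/

/-- The constants `k_±`, as functions of `α_±` and of the masses. -/
def kConst (S : Masses) (α : ℝ) : ℝ :=
  S.m₁ / S.m₂ * Real.sqrt ((S.m₀ + S.μ * S.m₂) / (S.m₀ + S.μ * S.m₁) * α)

/-- The set `𝓛` of the pairs `(Λ₁, Λ₂)` with `Λ_- < Λ₂ < Λ_+` and `k_- Λ₂ < Λ₁ < k_+ Λ₂`. -/
def calL (S : Masses) (αmin αmax Λmin Λmax : ℝ) : Set (ℝ × ℝ) :=
  {L | Λmin < L.2 ∧ L.2 < Λmax ∧ kConst S αmin * L.2 < L.1 ∧ L.1 < kConst S αmax * L.2}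

/-- `𝓜_ε = 𝓛 × 𝕋² × B⁶_ε(0)`, in `RPS_π` coordinates. -/
def calM (S : Masses) (αmin αmax Λmin Λmax ε : ℝ) : Set RPSHat :=
  {w | (w.Λ₁, w.Λ₂) ∈ calL S αmin αmax Λmin Λmax ∧ Real.sqrt w.zSq < ε}

/-- `𝓜_ε(G) = 𝓜_ε ∩ {G_{RPS_π} = G}`. -/
def calMAt (S : Masses) (αmin αmax Λmin Λmax ε G : ℝ) : Set RPSHat :=
  {w | w ∈ calM S αmin αmax Λmin Λmax ε ∧ w.G = G}

/-- The image of a set `A` of `RPS_π` coordinates under the change of coordinates from `RPS_π` to the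
perihelia coordinates `(p̂, G, g)`, at given values of the common pair `(Z, ζ)`. A pair of
coordinate values corresponds under the change when it comes from one and the same state. -/
def changeImage (S : Masses) (Z : ℝ) (ζ : Real.Angle) (A : Set RPSHat) :
    Set (PHat × ℝ × Real.Angle) :=
  {b | ∃ s : State, s.RPSDomain S ∧ s.PDomain S ∧ s.Z = Z ∧ s.ζ = ζ ∧
    s.rpsHat S ∈ A ∧ (s.pHat S, s.G, s.g S) = b}

/-- The factor `𝓜̂'_ε(G)` of the splitting `𝓜'_ε(G) = 𝓜̂'_ε(G) × {G} × {g ∈ 𝕋}` of the image of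
`𝓜_ε(G)`. Points are required to belong to the image for every `g` and for every admissible value of
the cyclic pair `(Z, ζ)`; by invariance under rotations the choice of these is immaterial. -/
def calMHatPrime (S : Masses) (αmin αmax Λmin Λmax ε G : ℝ) : Set PHat :=
  {a | ∀ (Z : ℝ) (ζ g : Real.Angle), |Z| < G →
    (a, G, g) ∈ changeImage S Z ζ (calMAt S αmin αmax Λmin Λmax ε G)}

/-- The box `𝓝₁(G, ε) = 𝓐₁(G) × 𝕋³ × 𝓑₁(G, ε)`, with constant `c` in place of `c₁`. The angle `ϑ`
is represented in `(-π, π]`. -/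
def calN₁ (S : Masses) (αmin αmax Λmin Λmax c γ G ε : ℝ) : Set PHat :=
  {a | (a.Λ₁, a.Λ₂) ∈ calL S αmin αmax Λmin Λmax ∧
    |a.Λ₁ - a.Λ₂ - G| < c ^ 2 * ε ^ 2 ∧
    a.Λ₂ - c ^ 2 * ε ^ 2 < a.G₂ ∧ a.G₂ < a.Λ₂ - γ ∧
    a.Θ ^ 2 < c ^ 2 * G * ε ^ 2 ∧ a.ϑ.toReal ^ 2 < c ^ 2 * (ε ^ 2 / G)}

end ThreeBody

end

namespace ThreeBody

/-! ### Lengths and right-handed orthonormal frames -/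

/-! Membership in `calMHatPrime` asks for two things: an actual state realizing given perihelia
coordinates, and smallness of its `RPS_π` variables.

Existence is geometric. Since `C₁ ⟂ P₁`, the vectors `C` and `C₂ = C - C₁` have the same component
`Θ` along `P₁`, so the coordinates are Euler-type angles along the chain `k₃, C, P₁, C₂, P₂`.
Successive rotations and tilts of a frame build these vectors (`exists_configuration`), and
`exists_kepler_state` puts an ellipse on each orbital plane, giving `exists_state`.

Smallness involves no angles: `|z|²/2` is the sum of `Λ₁ - G₁`, `Λ₂ - G₂` and the defect `d = G + G₂
- G₁` (`State.rpsHat_radii`). As `Λ₁ - G₁ = (Λ₁ - Λ₂ - G) + (Λ₂ - G₂) + d`, it remains to bound `d`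
by a multiple of `c² ε²`. The identity `(G + G₂)² - G₁² = 2 (G G₂ + C · C₂)` shows that `d` is
quadratically small in `(Θ, ϑ)`, with a factor `1/G₂` that degenerates for small `G₂`; there the
triangle inequality `d ≤ 2 G₂` takes over (`PHat.defect_le_of_mem_calN₁`). -/

lemma dot_self_nonneg (v : V3) : 0 ≤ v ⬝ᵥ v := by
  rw [Matrix.vec3_dotProduct]; nlinarith [sq_nonneg (v 0), sq_nonneg (v 1), sq_nonneg (v 2)]

lemma len_sq (v : V3) : len v ^ 2 = v ⬝ᵥ v := Real.sq_sqrt (dot_self_nonneg v)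

lemma len_eq_of_dot {v : V3} {r : ℝ} (hr : 0 ≤ r) (h : v ⬝ᵥ v = r ^ 2) : len v = r := by
  rw [len, h, Real.sqrt_sq hr]

lemma len_smul {v : V3} {r : ℝ} (hr : 0 ≤ r) (hv : v ⬝ᵥ v = 1) : len (r • v) = r :=
  len_eq_of_dot hr (by simp only [smul_dotProduct, dotProduct_smul, smul_eq_mul, hv]; ring)

lemma smul_ne_zero_of_dot {v : V3} {r : ℝ} (hr : r ≠ 0) (hv : v ⬝ᵥ v = 1) : r • v ≠ 0 := by
  intro h0
  have : v = 0 := (smul_eq_zero.1 h0).resolve_left hr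
  simp [this] at hv

/-- A positively oriented orthonormal frame. -/
structure IsFrame (u v w : V3) : Prop where
  uu : u ⬝ᵥ u = 1
  vv : v ⬝ᵥ v = 1
  ww : w ⬝ᵥ w = 1
  uv : u ⬝ᵥ v = 0
  vw : v ⬝ᵥ w = 0
  wu : w ⬝ᵥ u = 0
  cuv : u ⨯₃ v = w
  cvw : v ⨯₃ w = u
  cwu : w ⨯₃ u = v

namespace IsFrame

variable {u v w : V3}

lemma vu (h : IsFrame u v w) : v ⬝ᵥ u = 0 := by rw [dotProduct_comm, h.uv]
lemma wv (h : IsFrame u v w) : w ⬝ᵥ v = 0 := by rw [dotProduct_comm, h.vw]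
lemma uw (h : IsFrame u v w) : u ⬝ᵥ w = 0 := by rw [dotProduct_comm, h.wu]
lemma cvu (h : IsFrame u v w) : v ⨯₃ u = -w := by rw [← cross_anticomm, h.cuv]
lemma cwv (h : IsFrame u v w) : w ⨯₃ v = -u := by rw [← cross_anticomm, h.cvw]
lemma cuw (h : IsFrame u v w) : u ⨯₃ w = -v := by rw [← cross_anticomm, h.cwu]

lemma cycle (h : IsFrame u v w) : IsFrame v w u :=
  ⟨h.vv, h.ww, h.uu, h.vw, h.wu, h.uv, h.cvw, h.cwu, h.cuv⟩

lemma dot_comb (h : IsFrame u v w) (a b c a' b' c' : ℝ) :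
    (a • u + b • v + c • w) ⬝ᵥ (a' • u + b' • v + c' • w) = a * a' + b * b' + c * c' := by
  simp only [add_dotProduct, dotProduct_add, smul_dotProduct, dotProduct_smul, smul_eq_mul,
    h.uu, h.vv, h.ww, h.uv, h.vw, h.wu, h.vu, h.wv, h.uw]
  ring

lemma cross_comb (h : IsFrame u v w) (a b c a' b' c' : ℝ) :
    (a • u + b • v + c • w) ⨯₃ (a' • u + b' • v + c' • w) =
      (b * c' - c * b') • u + (c * a' - a * c') • v + (a * b' - b * a') • w := by
  simp only [map_add, map_smul, LinearMap.add_apply, LinearMap.smul_apply, cross_self,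
    h.cuv, h.cvw, h.cwu, h.cvu, h.cwv, h.cuw]
  module

/-- Rotation about the third vector. -/
lemma rotate (h : IsFrame u v w) {c s : ℝ} (hcs : c ^ 2 + s ^ 2 = 1) :
    IsFrame (c • u + s • v) (-s • u + c • v) w := by
  -- Padding with zero coefficients brings all vectors to the form required by `dot_comb` and
  -- `cross_comb`.
  have e1 : c • u + s • v = c • u + s • v + (0 : ℝ) • w := by module
  have e2 : -s • u + c • v = (-s) • u + c • v + (0 : ℝ) • w := by module
  have e3 : w = (0 : ℝ) • u + (0 : ℝ) • v + (1 : ℝ) • w := by module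
  have hd := h.dot_comb
  have hc := h.cross_comb
  constructor
  · rw [e1, hd]; linear_combination hcs
  · rw [e2, hd]; linear_combination hcs
  · exact h.ww
  · rw [e1, e2, hd]; ring
  · have t := hd (-s) c 0 0 0 1
    rw [← e3, ← e2] at t; rw [t]; ring
  · have t := hd 0 0 1 c s 0
    rw [← e3, ← e1] at t; rw [t]; ring
  · rw [e1, e2, hc]
    have : c * c - s * -s = 1 := by linear_combination hcs
    rw [this]; module
  · have t := hc (-s) c 0 0 0 1
    rw [← e3, ← e2] at t; rw [t]; module
  · have t := hc 0 0 1 c s 0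
    rw [← e3, ← e1] at t; rw [t]; module

/-- Tilting the third vector by means of a rotation about the first one. -/
lemma tilt (h : IsFrame u v w) {t r : ℝ} (htr : t ^ 2 + r ^ 2 = 1) :
    IsFrame u (t • v + r • w) (-r • v + t • w) :=
  (h.cycle.rotate htr).cycle.cycle

/-- The angle from `u` to `cos θ u + sin θ v` around `w` is `θ`. -/
lemma ang_eq (h : IsFrame u v w) {a b c : ℝ} (ha : 0 < a) (hb : 0 < b) (hc : 0 < c)
    (θ : Real.Angle) : ang (a • w) (b • u) (c • (θ.cos • u + θ.sin • v)) = θ := by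
  have h1 : (b • u) ⬝ᵥ (c • (θ.cos • u + θ.sin • v)) = (b * c) * θ.cos := by
    simp only [dotProduct_add, smul_dotProduct, dotProduct_smul, smul_eq_mul, h.uu, h.uv]; ring
  have h2 : (a • w) ⬝ᵥ ((b • u) ⨯₃ (c • (θ.cos • u + θ.sin • v))) = a * (b * c * θ.sin) := by
    simp only [map_add, map_smul, LinearMap.smul_apply, cross_self, h.cuv, dotProduct_add,
      smul_dotProduct, dotProduct_smul, smul_eq_mul, h.ww, dotProduct_zero]; ring
  have h3 : len (a • w) = a := len_smul ha.le h.ww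
  rw [ang, h1, h2, h3, mul_div_cancel_left₀ _ ha.ne']
  -- The lengths leave only the positive factor `b * c`, and `θ.toReal` lies in `(-π, π]`, the range
  -- of `Complex.arg`.
  have h4 : (⟨b * c * θ.cos, b * c * θ.sin⟩ : ℂ) =
      ((b * c : ℝ) : ℂ) * (Complex.cos θ.toReal + Complex.sin θ.toReal * Complex.I) := by
    rw [← Complex.ofReal_cos, ← Complex.ofReal_sin, Real.Angle.cos_toReal, Real.Angle.sin_toReal]
    apply Complex.ext <;> simp
  rw [h4, Complex.arg_mul_cos_add_sin_mul_I (mul_pos hb hc) (θ.toReal_mem_Ioc),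
    Real.Angle.coe_toReal]

/-- Rotating by `θ` about the third vector and then tilting it so that the old and the new third
vector have inner product `t`. -/
lemma exists_rotate_tilt (h : IsFrame u v w) (θ : Real.Angle) {t : ℝ} (ht : |t| < 1) :
    ∃ v' w' : V3, IsFrame (θ.cos • u + θ.sin • v) v' w' ∧
      w ⨯₃ w' = Real.sqrt (1 - t ^ 2) • (θ.cos • u + θ.sin • v) ∧ w ⬝ᵥ w' = t ∧
      w' = t • w - Real.sqrt (1 - t ^ 2) • (-θ.sin • u + θ.cos • v) ∧
      w = t • w' + Real.sqrt (1 - t ^ 2) • v' := by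
  have h1 := h.rotate (θ.cos_sq_add_sin_sq)
  obtain ⟨r, hr⟩ : ∃ r, r = Real.sqrt (1 - t ^ 2) := ⟨_, rfl⟩
  have hs : r ^ 2 = 1 - t ^ 2 := hr ▸
    Real.sq_sqrt (by have := (sq_lt_one_iff_abs_lt_one t).2 ht; linarith)
  have h2 := h1.tilt (t := t) (r := r) (by rw [hs]; ring)
  rw [← hr]
  refine ⟨_, _, h2, ?_, ?_, by module, ?_⟩
  · simp only [map_add, map_smul, cross_self, h1.cwv]
    module
  · simp only [dotProduct_add, dotProduct_smul, h1.ww, h1.wv, smul_eq_mul]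
    ring
  · have : w = (t ^ 2 + r ^ 2) • w := by rw [hs]; module
    nth_rw 1 [this]
    module

/-- Two orthonormal vectors are part of a positively oriented orthonormal frame. -/
lemma of_orthonormal (hu : u ⬝ᵥ u = 1) (hw : w ⬝ᵥ w = 1) (huw : u ⬝ᵥ w = 0) :
    IsFrame u (w ⨯₃ u) w := by
  have hv : (w ⨯₃ u) ⬝ᵥ (w ⨯₃ u) = 1 := by
    rw [cross_dot_cross, hu, hw, huw]; ring
  refine ⟨hu, hv, hw, dot_cross_self _ _, ?_, by rw [dotProduct_comm, huw], ?_, ?_, rfl⟩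
  · rw [dotProduct_comm, dot_self_cross]
  · rw [Matrix.vec3_dotProduct] at hu huw
    ext i
    fin_cases i <;> simp [cross_apply]
    · linear_combination w 0 * hu - u 0 * huw
    · linear_combination w 1 * hu - u 1 * huw
    · linear_combination w 2 * hu - u 2 * huw
  · rw [Matrix.vec3_dotProduct] at hw huw
    ext i
    fin_cases i <;> simp [cross_apply]
    · linear_combination u 0 * hw - w 0 * huw
    · linear_combination u 1 * hw - w 1 * huw
    · linear_combination u 2 * hw - w 2 * huw

end IsFrame

lemma isFrame_standard : IsFrame k1 ![0, 1, 0] k3 := by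
  constructor <;> simp [k1, k3, cross_apply]

/-! ### The Kepler map -/

/-- The map `u ↦ u - e sin u` fixes `±π`, so the intermediate value theorem suffices. Only
surjectivity matters here, hence no bound on `e`. -/
lemma exists_kepler_equation {e : ℝ} (ℓ : Real.Angle) :
    ∃ u ∈ Set.Ioc (-Real.pi) Real.pi, ((u - e * Real.sin u : ℝ) : Real.Angle) = ℓ := by
  have hc : ContinuousOn (fun u : ℝ => u - e * Real.sin u) (Set.Icc (-Real.pi) Real.pi) := by
    fun_prop
  have h := intermediate_value_Ioc (by linarith [Real.pi_pos]) hc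
  obtain ⟨u, hu, hue⟩ := h (show ℓ.toReal ∈ _ by simpa using ℓ.toReal_mem_Ioc)
  exact ⟨u, hu, by rw [show u - e * Real.sin u = ℓ.toReal from hue, ℓ.coe_toReal]⟩

/-- There is a Kepler state with prescribed action `Λ`, angular momentum, perihelion direction and
mean anomaly. -/
lemma exists_kepler_state {m M Λ c : ℝ} (hm : 0 < m) (hM : 0 < M) (hc : 0 < c) (hcΛ : c < Λ)
    {P Q W : V3} (h : IsFrame P Q W) (ℓ : Real.Angle) :
    ∃ y x : V3, IsNoncircularEllipse m M y x ∧ angMom y x = c • W ∧ Lam m M y x = Λ ∧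
      periDir m M y x = P ∧ meanAnomaly m M y x = ℓ := by
  have hΛ : 0 < Λ := hc.trans hcΛ
  -- The axis ratio `β = √(1 - e²)` is forced by `|C| = Λ √(1 - e²)`; the strict inequality `c < Λ`
  -- makes `e` positive.
  obtain ⟨β, hβ⟩ : ∃ β, β = c / Λ := ⟨_, rfl⟩
  have hβ0 : 0 < β := hβ ▸ div_pos hc hΛ
  have hβ1 : β < 1 := hβ ▸ (div_lt_one hΛ).2 hcΛ
  obtain ⟨e, he⟩ : ∃ e, e = Real.sqrt (1 - β ^ 2) := ⟨_, rfl⟩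
  have he2 : e ^ 2 = 1 - β ^ 2 := he ▸ Real.sq_sqrt (by nlinarith)
  have he0 : 0 < e := he ▸ Real.sqrt_pos.2 (by nlinarith)
  have he1 : e < 1 := by nlinarith
  have hβe : Real.sqrt (1 - e ^ 2) = β := by
    rw [he2, sub_sub_cancel, Real.sqrt_sq hβ0.le]
  obtain ⟨u, hu, hue⟩ := exists_kepler_equation (e := e) ℓ
  set C := Real.cos u
  set s := Real.sin u
  have hCs : s ^ 2 + C ^ 2 = 1 := Real.sin_sq_add_cos_sq u
  have hC1 : C ≤ 1 := Real.cos_le_one u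
  obtain ⟨ρ, hρ⟩ : ∃ ρ, ρ = 1 - e * C := ⟨_, rfl⟩
  have hρ0 : 0 < ρ := by rw [hρ]; nlinarith [Real.neg_one_le_cos u]
  -- This solves `Λ = m √(M a)`. Below, `x` is the point of eccentric anomaly `u` on the ellipse and
  -- `y = m ẋ`, with `u̇ = √(M / a³) / ρ`.
  obtain ⟨a, ha⟩ : ∃ a, a = Λ ^ 2 / (m ^ 2 * M) := ⟨_, rfl⟩
  have ha0 : 0 < a := by rw [ha]; positivity
  obtain ⟨x, hx⟩ : ∃ x, x = (a * (C - e)) • P + (a * β * s) • Q + (0 : ℝ) • W := ⟨_, rfl⟩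
  obtain ⟨y, hy⟩ : ∃ y, y = (-(m ^ 2 * M / (Λ * ρ)) * s) • P +
    (m ^ 2 * M / (Λ * ρ) * β * C) • Q + (0 : ℝ) • W := ⟨_, rfl⟩
  have hxl : len x = a * ρ := by
    apply len_eq_of_dot (by positivity)
    rw [hx, h.dot_comb, hρ]
    linear_combination a ^ 2 * s ^ 2 * he2 + (a ^ 2 - a ^ 2 * e ^ 2) * hCs
  have hang : angMom y x = c • W := by
    rw [angMom, hx, hy, h.cross_comb]
    have : a * (C - e) * (m ^ 2 * M / (Λ * ρ) * β * C) -
        a * β * s * (-(m ^ 2 * M / (Λ * ρ)) * s) = c := by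
      have : C * (C - e) + s ^ 2 = ρ := by rw [hρ]; linear_combination hCs
      rw [ha, hβ]; field_simp; linear_combination this
    rw [this]; module
  have hE : keplerEnergy m M y x = -(m * M) / (2 * a) := by
    have hyy : y ⬝ᵥ y = (m ^ 2 * M / Λ) ^ 2 * (1 + e * C) / ρ := by
      rw [hy, h.dot_comb]
      have : s ^ 2 + β ^ 2 * C ^ 2 = ρ * (1 + e * C) := by
        rw [hρ]; linear_combination hCs + C ^ 2 * he2
      field_simp
      linear_combination m ^ 4 * M ^ 2 * this
    rw [keplerEnergy, hyy, hxl, ha]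
    field_simp
    rw [hρ]; ring
  have hsm : semiMajor m M y x = a := by
    rw [semiMajor, hE]; field_simp
  have hev : eccVector m M y x = e • P := by
    rw [eccVector, hang, hxl, hy, hx]
    have h3 : c • W = (0 : ℝ) • P + (0 : ℝ) • Q + c • W := by module
    rw [h3, h.cross_comb]
    have e1 : (m ^ 2 * M)⁻¹ * (m ^ 2 * M / (Λ * ρ) * β * C * c - 0 * 0) -
        (a * ρ)⁻¹ * (a * (C - e)) = e := by
      have : β ^ 2 * C - (C - e) = e * ρ := by rw [hρ]; linear_combination C * he2
      have h4 : c = β * Λ := by rw [hβ]; field_simp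
      rw [h4]; field_simp; linear_combination m ^ 2 * M * this
    have e2 : (m ^ 2 * M)⁻¹ * (0 * 0 - -(m ^ 2 * M / (Λ * ρ)) * s * c) -
        (a * ρ)⁻¹ * (a * β * s) = 0 := by
      rw [hβ]; field_simp; ring
    calc _ = ((m ^ 2 * M)⁻¹ * (m ^ 2 * M / (Λ * ρ) * β * C * c - 0 * 0) -
        (a * ρ)⁻¹ * (a * (C - e))) • P + ((m ^ 2 * M)⁻¹ * (0 * 0 - -(m ^ 2 * M / (Λ * ρ)) * s * c) -
        (a * ρ)⁻¹ * (a * β * s)) • Q := by module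
      _ = e • P := by rw [e1, e2]; module
  have hecc : ecc m M y x = e := by
    rw [ecc, hev]
    exact len_smul he0.le h.uu
  have hP : periDir m M y x = P := by
    rw [periDir, hecc, hev, smul_smul, inv_mul_cancel₀ he0.ne', one_smul]
  have hcl : len (c • W) = c := len_smul hc.le h.ww
  have hN : periNormal m M y x = Q := by
    rw [periNormal, hang, hP, hcl, smul_smul, inv_mul_cancel₀ hc.ne', one_smul, h.cwu]
  refine ⟨y, x, ⟨?_, ?_, ?_, ?_⟩, hang, ?_, hP, ?_⟩
  · rintro rfl
    have : (0 : ℝ) < a * ρ := by positivity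
    rw [← hxl] at this
    simp [len] at this
  · rw [hE]; apply div_neg_of_neg_of_pos <;> nlinarith
  · rw [hang]; exact smul_ne_zero_of_dot hc.ne' h.ww
  · rw [hev]; exact smul_ne_zero_of_dot he0.ne' h.uu
  · rw [Lam, hsm, ha]
    have : M * (Λ ^ 2 / (m ^ 2 * M)) = (Λ / m) ^ 2 := by field_simp
    rw [this, Real.sqrt_sq (by positivity)]; field_simp
  · have hxP : x ⬝ᵥ P = a * (C - e) := by
      have := h.dot_comb (a * (C - e)) (a * β * s) 0 1 0 0
      rw [← hx] at this
      simpa using this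
    have hxQ : x ⬝ᵥ Q = a * β * s := by
      have := h.dot_comb (a * (C - e)) (a * β * s) 0 0 1 0
      rw [← hx] at this
      simpa using this
    -- The argument of `Complex.arg` reduces to `cos u + i sin u`, and `u ∈ (-π, π]` is the
    -- principal branch.
    have hA : eccAnomaly m M y x = u := by
      rw [eccAnomaly, hP, hN, hecc, hsm, hβe, hxP, hxQ]
      have : (⟨a * (C - e) / a + e, a * β * s / (a * β)⟩ : ℂ) =
          Complex.cos u + Complex.sin u * Complex.I := by
        have h1 : a * (C - e) / a + e = C := by field_simp; ring
        have h2 : a * β * s / (a * β) = s := by field_simp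
        rw [← Complex.ofReal_cos, ← Complex.ofReal_sin, h1, h2]
        apply Complex.ext <;> simp only [Complex.add_re, Complex.add_im, Complex.mul_re,
          Complex.mul_im, Complex.ofReal_re, Complex.ofReal_im, Complex.I_re, Complex.I_im] <;>
          simp only [C, s] <;> ring
      rw [this, Complex.arg_cos_add_sin_mul_I hu]
    rw [meanAnomaly, hA, hecc, hue]

/-! ### States with prescribed perihelia coordinates -/

lemma mul_sqrt_one_sub_div_sq {a : ℝ} (ha : 0 < a) (t : ℝ) :
    a * Real.sqrt (1 - (t / a) ^ 2) = Real.sqrt (a ^ 2 - t ^ 2) := by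
  conv_lhs => rw [← Real.sqrt_sq ha.le]
  rw [← Real.sqrt_mul (sq_nonneg a), Real.sqrt_sq ha.le]
  congr 1
  field_simp

/-- Cauchy–Schwarz for the plane vectors `(t, √(a² - t²))` and `(t, √(b² - t²))`, of lengths `a` and
`b`; the difference of the squares is `t² (√(a² - t²) - √(b² - t²))²`. -/
lemma sqrt_sq_sub_sq_mul_le {a b t : ℝ} (ha : |t| < a) (hb : |t| < b) :
    t ^ 2 + Real.sqrt (a ^ 2 - t ^ 2) * Real.sqrt (b ^ 2 - t ^ 2) ≤ a * b := by
  have ha0 : 0 < a := (abs_nonneg t).trans_lt ha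
  have hb0 : 0 < b := (abs_nonneg t).trans_lt hb
  have h1 : t ^ 2 ≤ a ^ 2 := (sq_lt_sq' (abs_lt.1 ha).1 (abs_lt.1 ha).2).le
  have h2 : t ^ 2 ≤ b ^ 2 := (sq_lt_sq' (abs_lt.1 hb).1 (abs_lt.1 hb).2).le
  have h3 := Real.sq_sqrt (sub_nonneg.2 h1)
  have h4 := Real.sq_sqrt (sub_nonneg.2 h2)
  apply abs_le_of_sq_le_sq' _ (by positivity) |>.2
  nlinarith [sq_nonneg (t * (Real.sqrt (a ^ 2 - t ^ 2) - Real.sqrt (b ^ 2 - t ^ 2)))]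

lemma neg_one_lt_cos_of_ne_pi {θ : Real.Angle} (h : θ ≠ (Real.pi : Real.Angle)) :
    -1 < θ.cos := by
  refine lt_of_le_of_ne (θ.cos_toReal ▸ Real.neg_one_le_cos _) fun h1 => h ?_
  have h2 := θ.cos_sq_add_sin_sq
  rw [← h1] at h2
  have h3 : θ.sin = 0 := by nlinarith
  rcases Real.Angle.sin_eq_zero_iff.1 h3 with h4 | h4
  · rw [h4] at h1; norm_num at h1
  · exact h4

/-- A system of vectors `(C, C₂, P₁, P₂)` with prescribed mutual position. -/
lemma exists_configuration {G G₂ Θ Z : ℝ} (hΘG : |Θ| < G) (hΘG₂ : |Θ| < G₂) (hZ : |Z| < G)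
    (ζ g ϑ g₂ : Real.Angle) :
    ∃ C C₂ P₁ P₂ : V3, C ⬝ᵥ C = G ^ 2 ∧ C₂ ⬝ᵥ C₂ = G₂ ^ 2 ∧ P₁ ⬝ᵥ P₁ = 1 ∧ P₂ ⬝ᵥ P₂ = 1 ∧
      C ⬝ᵥ k3 = Z ∧ C ⬝ᵥ P₁ = Θ ∧ C₂ ⬝ᵥ P₁ = Θ ∧ P₂ ⬝ᵥ C₂ = 0 ∧
      C ⬝ᵥ C₂ = Θ ^ 2 - Real.sqrt (G ^ 2 - Θ ^ 2) * Real.sqrt (G₂ ^ 2 - Θ ^ 2) * ϑ.cos ∧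
      k3 ⨯₃ C ≠ 0 ∧ C ⨯₃ P₁ ≠ 0 ∧ P₁ ⨯₃ C₂ ≠ 0 ∧ C₂ ⨯₃ P₂ ≠ 0 ∧
      ang k3 k1 (k3 ⨯₃ C) = ζ ∧ ang C (k3 ⨯₃ C) (C ⨯₃ P₁) = g ∧
      ang P₁ (C ⨯₃ P₁) (P₁ ⨯₃ C₂) = ϑ ∧ ang C₂ (P₁ ⨯₃ C₂) (C₂ ⨯₃ P₂) = g₂ := by
  have hG : 0 < G := (abs_nonneg Θ).trans_lt hΘG
  have hG₂ : 0 < G₂ := (abs_nonneg Θ).trans_lt hΘG₂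
  have hdiv : ∀ {t a : ℝ}, 0 < a → |t| < a → |t / a| < 1 := fun ha h => by
    rwa [abs_div, abs_of_pos ha, div_lt_one ha]
  have hpos : ∀ {t : ℝ}, |t| < 1 → 0 < Real.sqrt (1 - t ^ 2) := fun h =>
    Real.sqrt_pos.2 (by have := (sq_lt_one_iff_abs_lt_one _).2 h; linarith)
  have hZ' := hdiv hG hZ
  have hΘ' := hdiv hG hΘG
  have hΘ₂' := hdiv hG₂ hΘG₂
  -- Each frame has the node of two consecutive vectors as first axis and the later vector as third:
  -- `(ν₁, C)`, `(n₁, P₁)`, `(ν₂, C₂)`, `(n₂, P₂)`, up to length. The tilts `Z/G`, `Θ/G`, `Θ/G₂`,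
  -- `0` are the cosines between consecutive vectors.
  obtain ⟨v₁, C, F₁, hc₁, hd₁, -, -⟩ := isFrame_standard.exists_rotate_tilt ζ hZ'
  obtain ⟨v₂, P₁, F₂, hc₂, hd₂, -, hC⟩ := F₁.exists_rotate_tilt g hΘ'
  obtain ⟨v₃, C₂, F₃, hc₃, hd₃, hC₂, -⟩ := F₂.exists_rotate_tilt ϑ hΘ₂'
  obtain ⟨v₄, P₂, F₄, hc₄, hd₄, -, -⟩ := F₃.exists_rotate_tilt g₂ (t := 0) (by simp)
  have hr₁ := hpos hZ'
  have hr₂ := hpos hΘ'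
  have hr₃ := hpos hΘ₂'
  have hCC : C ⬝ᵥ C₂ = Θ / G * (Θ / G₂) -
      Real.sqrt (1 - (Θ / G) ^ 2) * Real.sqrt (1 - (Θ / G₂) ^ 2) * ϑ.cos := by
    -- Both vectors are resolved in the frame with third axis `P₁`, where `ϑ` is the rotation from
    -- `n₁` to `ν₂`.
    rw [hC, hC₂]
    generalize g.cos • (ζ.cos • k1 + ζ.sin • ![0, 1, 0]) + g.sin • v₁ = n at F₂ ⊢
    simp only [add_dotProduct, dotProduct_add, dotProduct_sub, smul_dotProduct, dotProduct_smul,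
      smul_eq_mul, F₂.ww, F₂.vv, F₂.vw, F₂.wv, F₂.vu, F₂.wu]
    ring
  have e₁ : k3 ⨯₃ (G • C) = (G * Real.sqrt (1 - (Z / G) ^ 2)) •
      (ζ.cos • k1 + ζ.sin • ![0, 1, 0]) := by rw [map_smul, hc₁, smul_smul]
  have e₂ := congrArg (G • ·) hc₂
  have e₃ := congrArg (G₂ • ·) hc₃
  have e₄ := congrArg (G₂ • ·) hc₄
  simp only [smul_smul] at e₂ e₃ e₄
  rw [← LinearMap.smul_apply, ← map_smul] at e₂ e₄
  rw [← map_smul] at e₃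
  have hn₄ : 0 < G₂ * Real.sqrt (1 - (0 : ℝ) ^ 2) := by simpa using hG₂
  refine ⟨G • C, G₂ • C₂, P₁, P₂, ?_, ?_, F₂.ww, F₄.ww, ?_, ?_, ?_, ?_, ?_, ?_, ?_, ?_, ?_, ?_, ?_,
    ?_, ?_⟩
  · simp only [smul_dotProduct, dotProduct_smul, smul_eq_mul, F₁.ww]; ring
  · simp only [smul_dotProduct, dotProduct_smul, smul_eq_mul, F₃.ww]; ring
  · rw [smul_dotProduct, dotProduct_comm, hd₁, smul_eq_mul]; field_simp
  · rw [smul_dotProduct, hd₂, smul_eq_mul]; field_simp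
  · rw [smul_dotProduct, dotProduct_comm, hd₃, smul_eq_mul]; field_simp
  · rw [dotProduct_comm, smul_dotProduct, hd₄, smul_zero]
  · rw [← mul_sqrt_one_sub_div_sq hG, ← mul_sqrt_one_sub_div_sq hG₂]
    simp only [smul_dotProduct, dotProduct_smul, smul_eq_mul, hCC]
    field_simp
  · rw [e₁]; exact smul_ne_zero_of_dot (by positivity) F₁.uu
  · rw [e₂]; exact smul_ne_zero_of_dot (by positivity) F₂.uu
  · rw [e₃]; exact smul_ne_zero_of_dot (by positivity) F₃.uu
  · rw [e₄]; exact smul_ne_zero_of_dot hn₄.ne' F₄.uu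
  · rw [e₁]
    simpa using isFrame_standard.ang_eq one_pos one_pos (mul_pos hG hr₁) ζ
  · rw [e₁, e₂]; exact F₁.ang_eq hG (by positivity) (by positivity) g
  · rw [e₂, e₃]
    simpa using F₂.ang_eq one_pos (mul_pos hG hr₂) (mul_pos hG₂ hr₃) ϑ
  · rw [e₃, e₄]; exact F₃.ang_eq hG₂ (by positivity) hn₄ g₂

/-- The left side is `C · C₂`. Strictness excludes that `C₂` is a positive multiple of `C`, which is
how `ϑ ≠ π` enters: it gives `G₁ > 0` and leaves only the retrograde co-planar case. -/
lemma dot_lt_of_ne_pi {G G₂ Θ : ℝ} {ϑ : Real.Angle} (hΘG : |Θ| < G) (hΘG₂ : |Θ| < G₂)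
    (hϑ : ϑ ≠ (Real.pi : Real.Angle)) :
    Θ ^ 2 - Real.sqrt (G ^ 2 - Θ ^ 2) * Real.sqrt (G₂ ^ 2 - Θ ^ 2) * ϑ.cos < G * G₂ := by
  have h := sqrt_sq_sub_sq_mul_le hΘG hΘG₂
  have hA : 0 < Real.sqrt (G ^ 2 - Θ ^ 2) :=
    Real.sqrt_pos.2 (sub_pos.2 (sq_lt_sq' (abs_lt.1 hΘG).1 (abs_lt.1 hΘG).2))
  have hB : 0 < Real.sqrt (G₂ ^ 2 - Θ ^ 2) :=
    Real.sqrt_pos.2 (sub_pos.2 (sq_lt_sq' (abs_lt.1 hΘG₂).1 (abs_lt.1 hΘG₂).2))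
  nlinarith [mul_pos hA hB, neg_one_lt_cos_of_ne_pi hϑ]

lemma Masses.Pos.rm₁_pos {S : Masses} (h : S.Pos) : 0 < S.rm₁ := by
  obtain ⟨h0, h1, h2, h3⟩ := h; unfold Masses.rm₁; positivity

lemma Masses.Pos.rm₂_pos {S : Masses} (h : S.Pos) : 0 < S.rm₂ := by
  obtain ⟨h0, h1, h2, h3⟩ := h; unfold Masses.rm₂; positivity

lemma Masses.Pos.cm₁_pos {S : Masses} (h : S.Pos) : 0 < S.cm₁ := by
  obtain ⟨h0, h1, h2, h3⟩ := h; unfold Masses.cm₁; positivity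

lemma Masses.Pos.cm₂_pos {S : Masses} (h : S.Pos) : 0 < S.cm₂ := by
  obtain ⟨h0, h1, h2, h3⟩ := h; unfold Masses.cm₂; positivity

/-- Every point of the domain of the perihelia coordinates is realized by a state, which moreover
lies in the domain of `RPS_π`. -/
lemma exists_state {S : Masses} (hS : S.Pos) {G : ℝ} {a : PHat} (ha : a ∈ perihelionDomain G)
    {Z : ℝ} (hZ : |Z| < G) (ζ g : Real.Angle) :
    ∃ s : State, s.RPSDomain S ∧ s.PDomain S ∧ s.Z = Z ∧ s.ζ = ζ ∧ s.pHat S = a ∧ s.G = G ∧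
      s.g S = g ∧ s.G₁ = a.G₁ G := by
  obtain ⟨hG₂, hG₂Λ, hΘG, hΘG₂, hϑ, hG₁Λ⟩ := ha
  have hG : 0 < G := (abs_nonneg _).trans_lt hΘG
  obtain ⟨C, C₂, P₁, P₂, hC, hC₂, hP₁, hP₂, hCZ, hCP, hC₂P, hP₂C, hCC, hν₁, hn₁, hν₂, hn₂,
    hζ, hg, hϑ', hg₂⟩ := exists_configuration hΘG hΘG₂ hZ ζ g a.ϑ a.g₂
  have hlt := dot_lt_of_ne_pi hΘG hΘG₂ hϑ
  rw [← hCC] at hlt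
  have hC₁ : (C - C₂) ⬝ᵥ (C - C₂) = G ^ 2 + a.G₂ ^ 2 - 2 * (C ⬝ᵥ C₂) := by
    simp only [sub_dotProduct, dotProduct_sub, hC, hC₂, dotProduct_comm C₂ C]; ring
  have hlen₁ : len (C - C₂) = a.G₁ G := by
    rw [len, PHat.G₁, hC₁, hCC]; congr 1; ring
  have hlen₂ : len C₂ = a.G₂ := len_eq_of_dot hG₂.le hC₂
  have hlen : len C = G := len_eq_of_dot hG.le hC
  have hG₁sq : a.G₁ G ^ 2 = G ^ 2 + a.G₂ ^ 2 - 2 * (C ⬝ᵥ C₂) := by rw [← hlen₁, len_sq, hC₁]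
  -- From `C · C₂ < G G₂` one gets `G₁² > (G - G₂)²`.
  have hG₁ : 0 < a.G₁ G := by
    have h0 : 0 ≤ a.G₁ G := Real.sqrt_nonneg _
    refine lt_of_le_of_ne h0 fun h => ?_
    rw [← h] at hG₁sq
    nlinarith [sq_nonneg (G - a.G₂)]
  have hunit : ∀ {v : V3} {r : ℝ}, 0 < r → v ⬝ᵥ v = r ^ 2 → (r⁻¹ • v) ⬝ᵥ (r⁻¹ • v) = 1 := by
    intro v r hr h
    simp only [smul_dotProduct, dotProduct_smul, smul_eq_mul, h]
    field_simp
  -- Here `C₁ = C - C₂` is orthogonal to `P₁` because both terms have component `Θ` along it.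
  have F₁ : IsFrame P₁ _ ((a.G₁ G)⁻¹ • (C - C₂)) :=
    IsFrame.of_orthonormal hP₁ (hunit hG₁ (by rw [hC₁, hG₁sq])) (by
      rw [dotProduct_comm, smul_dotProduct, sub_dotProduct, hCP, hC₂P, sub_self, smul_zero])
  have F₂ : IsFrame P₂ _ ((a.G₂)⁻¹ • C₂) :=
    IsFrame.of_orthonormal hP₂ (hunit hG₂ hC₂) (by rw [dotProduct_smul, hP₂C, smul_zero])
  obtain ⟨y₁, x₁, hE₁, hA₁, hL₁, hp₁, hℓ₁⟩ :=
    exists_kepler_state hS.rm₁_pos hS.cm₁_pos hG₁ hG₁Λ F₁ a.ℓ₁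
  obtain ⟨y₂, x₂, hE₂, hA₂, hL₂, hp₂, hℓ₂⟩ :=
    exists_kepler_state hS.rm₂_pos hS.cm₂_pos hG₂ hG₂Λ F₂ a.ℓ₂
  rw [smul_smul, mul_inv_cancel₀ hG₁.ne', one_smul] at hA₁
  rw [smul_smul, mul_inv_cancel₀ hG₂.ne', one_smul] at hA₂
  obtain ⟨s, hs⟩ : ∃ s : State, s = ⟨y₁, y₂, x₁, x₂⟩ := ⟨_, rfl⟩
  have sC₁ : s.C₁ = C - C₂ := by rw [hs]; exact hA₁
  have sC₂ : s.C₂ = C₂ := by rw [hs]; exact hA₂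
  have sC : s.C = C := by rw [State.C, sC₁, sC₂, sub_add_cancel]
  have sP₁ : s.P₁ S = P₁ := by rw [hs]; exact hp₁
  have sP₂ : s.P₂ S = P₂ := by rw [hs]; exact hp₂
  have sν₁ : s.ν₁ = k3 ⨯₃ C := by rw [State.ν₁, sC]
  have sn₁ : s.n₁ S = C ⨯₃ P₁ := by rw [State.n₁, sC, sP₁]
  have sν₂ : s.ν₂ S = P₁ ⨯₃ C₂ := by rw [State.ν₂, sC₂, sP₁]
  have sn₂ : s.n₂ S = C₂ ⨯₃ P₂ := by rw [State.n₂, sC₂, sP₂]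
  have sG : s.G = G := by rw [State.G, sC, hlen]
  have sG₁ : s.G₁ = a.G₁ G := by rw [State.G₁, sC₁, hlen₁]
  have sG₂ : s.G₂ = a.G₂ := by rw [State.G₂, sC₂, hlen₂]
  have sE : s.Elliptic S := by rw [hs]; exact ⟨hE₁, hE₂⟩
  refine ⟨s, ⟨sE, sν₁ ▸ hν₁, ?_⟩, ⟨sE, sν₁ ▸ hν₁, sn₁ ▸ hn₁, sν₂ ▸ hν₂, sn₂ ▸ hn₂⟩, ?_, ?_, ?_, sG,
    ?_, sG₁⟩
  -- If the motion is co-planar, `C · C₂ = ± G G₂`. The plus sign is excluded by `hlt`, and the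
  -- minus sign means `G₁ = G + G₂`.
  · rw [or_iff_not_imp_left, not_not, sC, sC₁, sG, sG₁, sG₂]
    intro h
    have h1 : C ⨯₃ C₂ = 0 := by
      rw [map_sub, cross_self, zero_sub, neg_eq_zero] at h; exact h
    have h2 := cross_dot_cross C C₂ C C₂
    rw [h1, zero_dotProduct, dotProduct_comm C₂ C, hC, hC₂] at h2
    have h3 : (C ⬝ᵥ C₂ - G * a.G₂) * (C ⬝ᵥ C₂ + G * a.G₂) = 0 := by linear_combination h2
    have h4 : C ⬝ᵥ C₂ + G * a.G₂ = 0 :=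
      (mul_eq_zero.1 h3).resolve_left (sub_neg.2 hlt).ne
    have h5 : a.G₁ G ^ 2 = (G + a.G₂) ^ 2 := by rw [hG₁sq]; linear_combination (-2) * h4
    rw [(pow_left_inj₀ hG₁.le (by positivity) two_ne_zero).1 h5]; ring
  · rw [State.Z, sC, hCZ]
  · rw [State.ζ, sν₁, hζ]
  · ext1
    · rw [State.pHat, hs]; exact hL₁
    · rw [State.pHat, hs]; exact hL₂
    · exact sG₂
    · rw [State.pHat, sC, sP₁]; exact hCP
    · rw [State.pHat, hs]; exact hℓ₁
    · rw [State.pHat, hs]; exact hℓ₂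
    · rw [State.pHat, sC₂, sν₂, sn₂]; exact hg₂
    · rw [State.pHat, sP₁, sν₂, sn₁]; exact hϑ'
  · rw [State.g, sC, sν₁, sn₁, hg]

/-! ### Estimates -/

/-- The defect in the triangle inequality `G₁ ≤ G + G₂`. -/
lemma PHat.defect_nonneg {G : ℝ} {a : PHat} (ha : a ∈ perihelionDomain G) :
    0 ≤ G + a.G₂ - a.G₁ G := by
  obtain ⟨hG₂, -, hΘG, hΘG₂, -, -⟩ := ha
  have hG : 0 < G := (abs_nonneg _).trans_lt hΘG
  have h := sqrt_sq_sub_sq_mul_le hΘG hΘG₂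
  have hcos : a.ϑ.cos ≤ 1 := a.ϑ.cos_toReal ▸ Real.cos_le_one _
  rw [sub_nonneg, PHat.G₁, Real.sqrt_le_left (by positivity)]
  nlinarith [hcos,
    mul_nonneg (Real.sqrt_nonneg (G ^ 2 - a.Θ ^ 2)) (Real.sqrt_nonneg (a.G₂ ^ 2 - a.Θ ^ 2)),
    sq_nonneg a.Θ]

/-- The defect is at most `2 G₂`. -/
lemma PHat.defect_le {G : ℝ} {a : PHat} (ha : a ∈ perihelionDomain G) :
    G + a.G₂ - a.G₁ G ≤ 2 * a.G₂ := by
  obtain ⟨hG₂, -, hΘG, hΘG₂, hϑ, -⟩ := ha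
  have h := dot_lt_of_ne_pi hΘG hΘG₂ hϑ
  have : G - a.G₂ ≤ a.G₁ G := Real.le_sqrt_of_sq_le (by nlinarith)
  linarith

/-- The defect is quadratically small in `(Θ, ϑ)`. -/
lemma PHat.defect_le_sq {G : ℝ} {a : PHat} (ha : a ∈ perihelionDomain G) :
    G + a.G₂ - a.G₁ G ≤ 2 * a.Θ ^ 2 * (G + a.G₂) / (G * a.G₂) + G * a.ϑ.toReal ^ 2 := by
  have hnn := PHat.defect_nonneg ha
  obtain ⟨hG₂, -, hΘG, hΘG₂, hϑ, -⟩ := ha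
  have hG : 0 < G := (abs_nonneg _).trans_lt hΘG
  have hcos : 1 - a.ϑ.toReal ^ 2 / 2 ≤ a.ϑ.cos := by
    rw [← Real.Angle.cos_toReal]; exact Real.one_sub_sq_div_two_le_cos
  have h1 : a.Θ ^ 2 ≤ G ^ 2 := (sq_lt_sq' (abs_lt.1 hΘG).1 (abs_lt.1 hΘG).2).le
  have h2 : a.Θ ^ 2 ≤ a.G₂ ^ 2 := (sq_lt_sq' (abs_lt.1 hΘG₂).1 (abs_lt.1 hΘG₂).2).le
  have hle := sqrt_sq_sub_sq_mul_le hΘG hΘG₂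
  have hlt := dot_lt_of_ne_pi hΘG hΘG₂ hϑ
  have hG₁ : a.G₁ G ^ 2 = G ^ 2 + a.G₂ ^ 2 - 2 * a.Θ ^ 2 +
      2 * Real.sqrt (G ^ 2 - a.Θ ^ 2) * Real.sqrt (a.G₂ ^ 2 - a.Θ ^ 2) * a.ϑ.cos :=
    Real.sq_sqrt (by nlinarith [sq_nonneg (G - a.G₂)])
  have hG₁0 : 0 ≤ a.G₁ G := Real.sqrt_nonneg _
  obtain ⟨X, hX⟩ : ∃ X, X = Real.sqrt (G ^ 2 - a.Θ ^ 2) * Real.sqrt (a.G₂ ^ 2 - a.Θ ^ 2) :=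
    ⟨_, rfl⟩
  have hX0 : 0 ≤ X := hX ▸ by positivity
  have hX2 : X ^ 2 = (G ^ 2 - a.Θ ^ 2) * (a.G₂ ^ 2 - a.Θ ^ 2) := by
    rw [hX, mul_pow, Real.sq_sqrt (sub_nonneg.2 h1), Real.sq_sqrt (sub_nonneg.2 h2)]
  rw [← hX] at hle
  have hp : 0 < G * a.G₂ := by positivity
  have hq := sq_nonneg a.Θ
  have hXle : X ≤ G * a.G₂ := by linarith
  -- From `(G G₂)² - X² ≤ Θ² (G² + G₂²)`, dividing by `G G₂ + X ≥ G G₂`.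
  have hgap : G * a.G₂ - X ≤ a.Θ ^ 2 * (G ^ 2 + a.G₂ ^ 2) / (G * a.G₂) := by
    rw [le_div_iff₀ hp]
    nlinarith [mul_nonneg hX0 (sub_nonneg.2 hXle), mul_nonneg hq hq]
  have hmain : (G + a.G₂) ^ 2 - a.G₁ G ^ 2 ≤
      (2 * a.Θ ^ 2 * (G + a.G₂) / (G * a.G₂) + G * a.ϑ.toReal ^ 2) * (G + a.G₂) := by
    have e1 : 2 * a.Θ ^ 2 * (G + a.G₂) / (G * a.G₂) * (G + a.G₂) =
        2 * (a.Θ ^ 2 * (G ^ 2 + a.G₂ ^ 2) / (G * a.G₂)) + 4 * a.Θ ^ 2 := by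
      field_simp; ring
    have e2 : (G + a.G₂) ^ 2 - a.G₁ G ^ 2 = 2 * (G * a.G₂) + 2 * a.Θ ^ 2 - 2 * (X * a.ϑ.cos) := by
      rw [hG₁, hX]; ring
    have e3 : X * (1 - a.ϑ.toReal ^ 2 / 2) ≤ X * a.ϑ.cos := mul_le_mul_of_nonneg_left hcos hX0
    have e4 : X * a.ϑ.toReal ^ 2 ≤ G * a.G₂ * a.ϑ.toReal ^ 2 :=
      mul_le_mul_of_nonneg_right hXle (sq_nonneg _)
    have e5 : 0 ≤ G * a.ϑ.toReal ^ 2 * G := by positivity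
    rw [e2, add_mul, e1]
    nlinarith
  have hs : 0 < G + a.G₂ := by positivity
  -- `(G + G₂)² - G₁²` is the defect times `G + G₂ + G₁`, and the nonnegative `G₁` in the second
  -- factor may be dropped.
  refine le_of_mul_le_mul_right (le_trans ?_ hmain) hs
  nlinarith [mul_nonneg hnn hG₁0]

/-- On the box `𝓝₁` the defect is of order `c² ε²`. -/
lemma PHat.defect_le_of_mem_calN₁ {S : Masses} {αmin αmax Λmin Λmax c γ G ε : ℝ} {a : PHat}
    (hΛ : 0 < Λmin) (ha : a ∈ perihelionDomain G)
    (h : a ∈ calN₁ S αmin αmax Λmin Λmax c γ G ε) :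
    G + a.G₂ - a.G₁ G ≤ (4 + 4 * (G / Λmin)) * (c ^ 2 * ε ^ 2) := by
  obtain ⟨⟨hΛ₂, -, -, -⟩, -, hG₂l, -, hΘ, hϑ⟩ := h
  simp only at hΛ₂
  have hle := PHat.defect_le ha
  have hsq := PHat.defect_le_sq ha
  obtain ⟨hG₂, hG₂Λ, hΘG, -⟩ := ha
  have hG : 0 < G := (abs_nonneg _).trans_lt hΘG
  set δ := c ^ 2 * ε ^ 2 with hδ
  have hδ0 : 0 ≤ δ := by positivity
  have hGΛ : 0 < G / Λmin := by positivity
  -- If `G₂ ≤ δ`, the bound `2 G₂` is enough. Otherwise `Λmin < Λ₂ < G₂ + δ < 2 G₂` controls `1 /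
  -- G₂`, and the quadratic bound gives `(3 + 4 G / Λmin) δ`.
  rcases le_or_gt a.G₂ δ with h1 | h1
  · nlinarith
  · have h2 : Λmin ≤ 2 * a.G₂ := by linarith
    have h3 : G * a.ϑ.toReal ^ 2 ≤ δ := by
      have : c ^ 2 * (ε ^ 2 / G) = δ / G := by rw [hδ]; ring
      rw [this, lt_div_iff₀ hG] at hϑ
      linarith
    have h4 : 2 * a.Θ ^ 2 * (G + a.G₂) / (G * a.G₂) ≤ 2 * δ * (1 + 2 * (G / Λmin)) := by
      have e1 : 2 * a.Θ ^ 2 * (G + a.G₂) / (G * a.G₂) = 2 * (a.Θ ^ 2 / G) * (1 + G / a.G₂) := by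
        field_simp; ring
      have e2 : a.Θ ^ 2 / G ≤ δ := by
        rw [div_le_iff₀ hG]; rw [hδ]; linarith
      have e3 : G / a.G₂ ≤ 2 * (G / Λmin) := by
        rw [div_le_iff₀ hG₂]
        have : G = G / Λmin * Λmin := by field_simp
        nlinarith
      rw [e1]
      gcongr
    nlinarith

/-! ### The `RPS_π` coordinates -/

/-- The angles drop out by `cos² + sin² = 1`, so the value chosen for the node in the co-planar case
is irrelevant. The sign hypotheses are needed because `Real.sqrt` vanishes on negative numbers. -/
lemma State.rpsHat_radii (S : Masses) (s : State) (h₁ : s.G₁ ≤ s.Λ₁ S) (h₂ : s.G₂ ≤ s.Λ₂ S)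
    (h : 0 ≤ s.G + s.G₂ - s.G₁) :
    (s.rpsHat S).η₁ ^ 2 + (s.rpsHat S).ξ₁ ^ 2 = 2 * (s.Λ₁ S - s.G₁) ∧
      (s.rpsHat S).η₂ ^ 2 + (s.rpsHat S).ξ₂ ^ 2 = 2 * (s.Λ₂ S - s.G₂) ∧
      (s.rpsHat S).p ^ 2 + (s.rpsHat S).q ^ 2 = 2 * (s.G + s.G₂ - s.G₁) := by
  have key : ∀ {r : ℝ} (θ : Real.Angle), 0 ≤ r →
      (Real.sqrt r * θ.cos) ^ 2 + (Real.sqrt r * θ.sin) ^ 2 = r ∧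
      (-Real.sqrt r * θ.cos) ^ 2 + (-Real.sqrt r * θ.sin) ^ 2 = r := by
    intro r θ hr
    have h1 := Real.sq_sqrt hr
    have h2 := θ.cos_sq_add_sin_sq
    constructor <;> linear_combination Real.sqrt r ^ 2 * h2 + h1
  exact ⟨(key _ (by linarith)).1, (key _ (by linarith)).2, (key _ (by linarith)).2⟩

end ThreeBody

/-! ### The choice of `c₁` and the inclusion -/

theorem mainTheorem6 :
    ∃ c₁ : ℝ → ℝ → ℝ, (∀ r s : ℝ, 0 < c₁ r s ∧ c₁ r s < 1) ∧
      ∀ (S : ThreeBody.Masses) (αmin αmax Λmin Λmax G ε γ : ℝ), S.Pos →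
        0 < αmin → αmin < αmax → αmax < 1 → 0 < Λmin → Λmin < Λmax → 0 < G → 0 < ε →
        γ < c₁ (Λmax / G) (Λmin / G) ^ 2 * ε ^ 2 →
        ThreeBody.calN₁ S αmin αmax Λmin Λmax (c₁ (Λmax / G) (Λmin / G)) γ G ε ∩
            ThreeBody.perihelionDomain G ⊆
          ThreeBody.calMHatPrime S αmin αmax Λmin Λmax ε G := by
  -- With `s = Λmin / G`, the number `24 + 16 G / Λmin` dominates the factor `22 + 16 G / Λmin`
  -- found below for `|z|²`. The absolute value keeps `c₁` in `(0, 1)` for every real `s`.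
  refine ⟨fun _ s => (24 + 16 * |s|⁻¹)⁻¹, fun r s => ?_, ?_⟩
  · have : 0 ≤ |s|⁻¹ := by positivity
    exact ⟨by positivity, inv_lt_one_of_one_lt₀ (by linarith)⟩
  intro S αmin αmax Λmin Λmax G ε γ hS _ _ _ hΛ _ hG hε _ a ⟨haN, haD⟩ Z ζ g hZ
  obtain ⟨s, hR, hP, sZ, sζ, sp, sG, sg, sG₁⟩ := ThreeBody.exists_state hS haD hZ ζ g
  refine ⟨s, hR, hP, sZ, sζ, ?_, by rw [sp, sG, sg]⟩
  have sΛ₁ : s.Λ₁ S = a.Λ₁ := congrArg ThreeBody.PHat.Λ₁ sp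
  have sΛ₂ : s.Λ₂ S = a.Λ₂ := congrArg ThreeBody.PHat.Λ₂ sp
  have sG₂ : s.G₂ = a.G₂ := congrArg ThreeBody.PHat.G₂ sp
  have hdef := ThreeBody.PHat.defect_le_of_mem_calN₁ hΛ haD haN
  have hnn := ThreeBody.PHat.defect_nonneg haD
  obtain ⟨hL, hΛG, hG₂l, -⟩ := haN
  obtain ⟨-, hG₂Λ, -, -, -, hG₁Λ⟩ := haD
  obtain ⟨r₁, r₂, r₃⟩ := s.rpsHat_radii S (by rw [sΛ₁, sG₁]; exact hG₁Λ.le)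
    (by rw [sΛ₂, sG₂]; exact hG₂Λ.le) (by rw [sG, sG₁, sG₂]; exact hnn)
  rw [sΛ₁, sG₁] at r₁
  rw [sΛ₂, sG₂] at r₂
  rw [sG, sG₁, sG₂] at r₃
  have e₁ : (s.rpsHat S).Λ₁ = a.Λ₁ := sΛ₁
  have e₂ : (s.rpsHat S).Λ₂ = a.Λ₂ := sΛ₂
  refine ⟨⟨by rw [e₁, e₂]; exact hL, ?_⟩, ?_⟩
  · rw [Real.sqrt_lt' hε, ThreeBody.RPSHat.zSq]
    have hx : 0 < G / Λmin := by positivity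
    have habs : |Λmin / G|⁻¹ = G / Λmin := by
      rw [abs_of_pos (by positivity), inv_div]
    simp only [habs] at hdef hΛG hG₂l
    obtain ⟨c, hc⟩ : ∃ c, c = (24 + 16 * (G / Λmin))⁻¹ := ⟨_, rfl⟩
    rw [← hc] at hdef hΛG hG₂l
    have hc0 : 0 < c := by rw [hc]; positivity
    have hc1 : c < 1 := by rw [hc]; exact inv_lt_one_of_one_lt₀ (by linarith)
    have hcm : (24 + 16 * (G / Λmin)) * c = 1 := by rw [hc]; field_simp
    have hδ : (24 + 16 * (G / Λmin)) * (c ^ 2 * ε ^ 2) < ε ^ 2 := by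
      have : (24 + 16 * (G / Λmin)) * (c ^ 2 * ε ^ 2) = c * ε ^ 2 := by
        linear_combination c * ε ^ 2 * hcm
      rw [this]
      nlinarith [pow_pos hε 2]
    -- With `d` the defect, `|z|² = 2 (Λ₁ - Λ₂ - G) + 4 (Λ₂ - G₂) + 4 d`, which is less than `2 + 4
    -- + 4 (4 + 4 G / Λmin)` times `c² ε²`.
    have := (abs_lt.1 hΛG).2
    linarith
  -- Substituting the three radii, `(Λ₁ - Λ₂) - (Λ₁ - G₁) + (Λ₂ - G₂) + (G + G₂ - G₁)` telescopes to
  -- `G`.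
  · rw [ThreeBody.RPSHat.G, e₁, e₂, r₁, r₂, r₃]; ring
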